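/- **Schemes.** A *scheme* for a function $f$ on a set of legal input streams is a one-round protocol between a Verifier and an untrusted Prover. Using random coins $R$ (fair random bits, tossed before the stream begins), Verifier makes one pass over the input stream $\sigma$, keeping a summary $\mathcal V_R(\sigma)$. After the input stream ends, Prover sends a bit string $H$ (the proof stream), which Verifier also reads in one pass; Verifier then outputs $\mathrm{out}_R(\mathcal V_R(\sigma),H)$, which is either a value or $\bot$ (reject). Verifier's space is the number of random bits tossed plus the number of bits of its working memory (an arbitrary update of the memory is allowed on each token that is read). The scheme has help cost at most $h$ and space cost at most $v$ if Verifier uses at most $v$ bits of space and * (perfect completeness) for every legal $\sigma$ there is an $H$ of at most $h$ bits, not depending on $R$, with $\Pr_R[\mathrm{out}_R(\mathcal V_R(\sigma),H)=f(\sigma)]=1$; * (soundness) for every legal $\sigma$ and every bit string $H'$ of any length, $\Pr_R[\mathrm{out}_R(\mathcal V_R(\sigma),H')\notin\{f(\sigma),\bot\}]\le 1/3$. **Input.** A graph $G$ on the vertex set $[n]$ is given as a stream of edge insertions and deletions: tokens $(u,v,\Delta)$ with $u,v\in[n]$, $\Delta\in\mathbb Z$, each adding $\Delta$ to the multiplicity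 of the pair $\{u,v\}$ (initially $0$). A stream is legal if at its end every pair $\{u,v\}$ with $u\ne v$ has multiplicity $0$ or $1$ and every loop has multiplicity $0$; then $G$ is the simple graph whose edges are the pairs of multiplicity $1$. In particular every stream listing each edge of a simple graph once is legal. **Theorem.** For all positive integers $t,s$ with $ts\ge n$ (in particular whenever $ts=n$), there is an $[nt,s]$-scheme for counting the connected components of an $n$-vertex graph. That is, there are constants $C$ and $k$ such that for all $n\ge 0$ and all integers $t,s\ge1$ with $ts\ge n$ there is a scheme that computes the number of connected components of an $n$-vertex graph given as above, with help cost at most $C\,nt\,(\lfloor\log_2 n\rfloor+1)^k$ and space cost at most $C\,s\,(\lfloor\log_2 n\rfloor+1)^k$ (with $\lfloor\log_2 0\rfloor$ read as $0$). -/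

import Mathlib

/-- A scheme in the annotated data streaming model, for input streams with tokens in `α` and
outputs in `β`. `Verifier` tosses `coins` fair random bits once, before the stream begins, and
keeps them; besides them it has a working memory of `mem` bits. It makes one pass over the input
stream, then one pass over the proof stream (a string of bits sent by `Prover`), updating its
memory after each token, and at the end it produces an element of `β`, or `none` for reject. -/
structure StreamScheme (α β : Type) where
  coins : ℕ
  mem : ℕ
  init : (Fin coins → Bool) → (Fin mem → Bool)
  readInput : (Fin coins → Bool) → (Fin mem → Bool) → α → (Fin mem → Bool)
  readHelp : (Fin coins → Bool) → (Fin mem → Bool) → Bool → (Fin mem → Bool)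
  decide : (Fin coins → Bool) → (Fin mem → Bool) → Option β

namespace StreamScheme

variable {α β : Type}

/-- The number of bits of space used by Verifier; the random coins are charged too. -/
def vcost (S : StreamScheme α β) : ℕ := S.coins + S.mem

/-- Verifier's summary of the input stream `σ` when the coin tosses are `R`. -/
def summary (S : StreamScheme α β) (R : Fin S.coins → Bool) (σ : List α) : Fin S.mem → Bool :=
  σ.foldl (S.readInput R) (S.init R)

/-- Verifier's output on summary `m` and proof stream `H` when the coin tosses are `R`. -/
def out (S : StreamScheme α β) (R : Fin S.coins → Bool) (m : Fin S.mem → Bool) (H : List Bool) :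
    Option β :=
  S.decide R (H.foldl (S.readHelp R) m)

/-- The probability of an event over the uniformly random coin tosses. -/
noncomputable def prob (S : StreamScheme α β) (E : (Fin S.coins → Bool) → Prop) : ℝ :=
  (Nat.card {R : Fin S.coins → Bool // E R} : ℝ) / (2 : ℝ) ^ S.coins

/-- Completeness error `0` with at most `hcost` bits of help: for each legal input stream there is
a proof stream of at most `hcost` bits (not depending on the coins) that makes Verifier output the
right value with probability `1`. -/
def PerfectlyComplete (S : StreamScheme α β) (D : Set (List α)) (f : List α → β) (hcost : ℕ) :
    Prop :=
  ∀ σ ∈ D, ∃ H : List Bool, H.length ≤ hcost ∧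
    S.prob (fun R => S.out R (S.summary R σ) H = some (f σ)) = 1

/-- Soundness error at most `ε`, against proof streams of any length. -/
def Sound (S : StreamScheme α β) (D : Set (List α)) (f : List α → β) (ε : ℝ) : Prop :=
  ∀ σ ∈ D, ∀ H : List Bool,
    S.prob (fun R => S.out R (S.summary R σ) H ≠ some (f σ) ∧
      S.out R (S.summary R σ) H ≠ none) ≤ ε

/-- `S` computes `f` on the legal input streams `D`, with help at most `h` bits, space at most `v`
bits, perfect completeness and soundness error at most `1/3`. -/
def Computes (S : StreamScheme α β) (D : Set (List α)) (f : List α → β) (h v : ℕ) : Prop :=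
  S.vcost ≤ v ∧ S.PerfectlyComplete D f h ∧ S.Sound D f (1 / 3)

end StreamScheme

/-- A token `(u, v, Δ)` adds `Δ` to the multiplicity of the edge `{u, v}`. -/
abbrev EdgeToken (n : ℕ) : Type := Fin n × Fin n × ℤ

/-- The multiplicity of the pair `e` after all of the stream has been read. -/
def edgeMult {n : ℕ} (σ : List (EdgeToken n)) (e : Sym2 (Fin n)) : ℤ :=
  (σ.map (fun τ => if s(τ.1, τ.2.1) = e then τ.2.2 else 0)).sum

/-- The streams of edge insertions and deletions that end up with a simple graph: all
multiplicities are `0` or `1` at the end, and those of loops are `0`. -/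
def graphStreams (n : ℕ) : Set (List (EdgeToken n)) :=
  {σ | ∀ e : Sym2 (Fin n), edgeMult σ e = 0 ∨ (edgeMult σ e = 1 ∧ ¬ e.IsDiag)}

/-- The graph on `n` vertices given by the stream. -/
def streamGraph {n : ℕ} (σ : List (EdgeToken n)) : SimpleGraph (Fin n) :=
  SimpleGraph.fromEdgeSet {e | edgeMult σ e = 1}

/-- The number of connected components of the graph given by the stream. -/
noncomputable def componentCount {n : ℕ} (σ : List (EdgeToken n)) : ℕ :=
  Nat.card (streamGraph σ).ConnectedComponent

/-! Prover names a spanning forest: each vertex gets a parent, a label and a depth. If labels are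
constant along edges, and every vertex that is not its own label is adjacent to a parent of depth
one less, then the components correspond to the vertices that are their own label
(`IsForestCertificate.card_components`).

Validity is a sum check. Each ordered pair `(u, v)` has a nonnegative integer violation, of degree
three in the entries of the adjacency, parent, label-difference and depth-difference matrices. The
total is below the prime `p`, so it vanishes mod `p` only if the certificate is valid. Splitting the
index `v` over a `t × s` grid turns each matrix into `s` columns of length `n * t`, each extended to
a polynomial of degree below `n * t`. The violations are then the sum over the `n * t` nodes of one
polynomial `Q` of degree below `3 * (n * t)`. Prover sends a polynomial `P`, claimed to be `Q`;
Verifier checks `P(r) = Q(r)` at a secret random `r`, and that the values of `P` at the nodes sum to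
zero. A false claim survives only at the few roots of `P - Q`.

Everything Verifier stores is linear in the data: the values at `r` of the `4 * s` column
polynomials, `P(r)`, the node sum of `P`, and the number of roots of the forest. So `4 * s + 3`
field elements, updated token by token, suffice; deletions cost nothing, and certificate and
coefficients can share one pass. -/

namespace StreamScheme

/-! ### Proof streams as sequences of tokens from a finite type -/

section BitTokens

variable {α β M T : Type}

/-- The tokens completed by a bit string, in blocks of `b` bits, when `buf` is already waiting. -/
def blockTokens (b : ℕ) (dT : List Bool → T) : List Bool → List Bool → List T
  | _, [] => []
  | buf, x :: xs =>
    if (buf ++ [x]).length = b then dT (buf ++ [x]) :: blockTokens b dT [] xs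
    else blockTokens b dT (buf ++ [x]) xs

theorem blockTokens_append (b : ℕ) (dT : List Bool → T) (l : List Bool) :
    ∀ buf H : List Bool, l ≠ [] → buf.length + l.length = b →
      blockTokens b dT buf (l ++ H) = dT (buf ++ l) :: blockTokens b dT [] H := by
  induction l with
  | nil => intro _ _ h; exact absurd rfl h
  | cons x l ih =>
    intro buf H _ hb
    rw [List.cons_append, blockTokens]
    by_cases hl : l = []
    · subst hl
      rw [if_pos (by simpa using hb)]
      rfl
    · have := List.length_pos_of_ne_nil hl
      rw [if_neg (by simp at hb ⊢; omega), ih _ _ hl (by simp at hb ⊢; omega)]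
      simp

theorem exists_blockTokens_eq {b : ℕ} (hb : 0 < b) {dT : List Bool → T}
    (hdT : ∀ a, ∃ l : List Bool, l.length = b ∧ dT l = a) (w : List T) :
    ∃ H : List Bool, H.length = b * w.length ∧ blockTokens b dT [] H = w := by
  induction w with
  | nil => exact ⟨[], by simp, rfl⟩
  | cons a w ih =>
    obtain ⟨H, hH, hw⟩ := ih
    obtain ⟨l, hl, rfl⟩ := hdT a
    refine ⟨l ++ H, by simp [hH, hl]; ring, ?_⟩
    rw [blockTokens_append b dT l [] H (by rintro rfl; simp at hl; omega) (by simpa using hl), hw]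
    rfl

/-- One step of a token machine that is fed with bits. -/
def bitStep (b : ℕ) (dT : List Bool → T) (rH : M → T → M) (q : M × List Bool) (x : Bool) :
    M × List Bool :=
  if (q.2 ++ [x]).length = b then (rH q.1 (dT (q.2 ++ [x])), []) else (q.1, q.2 ++ [x])

theorem bitStep_length {b : ℕ} (dT : List Bool → T) (rH : M → T → M) {q : M × List Bool}
    (hq : q.2.length < b) (x : Bool) : (bitStep b dT rH q x).2.length < b := by
  unfold bitStep
  split_ifs with h
  · simp; omega
  · simp at h ⊢; omega

theorem foldl_bitStep (b : ℕ) (dT : List Bool → T) (rH : M → T → M) (H : List Bool) :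
    ∀ q : M × List Bool,
      (H.foldl (bitStep b dT rH) q).1 = (blockTokens b dT q.2 H).foldl rH q.1 := by
  induction H with
  | nil => intro q; rfl
  | cons x H ih =>
    intro q
    rw [List.foldl_cons, ih, blockTokens]
    unfold bitStep
    split_ifs <;> rfl

/-- The decoder is total, so every block of bits, honest or not, is some token and soundness need
only be checked over token sequences. -/
theorem exists_bit_decoder [Fintype T] [Nonempty T] {b : ℕ} (hT : Fintype.card T ≤ 2 ^ b) :
    ∃ dT : List Bool → T, ∀ a, ∃ l : List Bool, l.length = b ∧ dT l = a := by
  obtain ⟨e⟩ : Nonempty (T ↪ (Fin b → Bool)) :=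
    Function.Embedding.nonempty_of_card_le (by simpa using hT)
  have hinj : Function.Injective fun a => List.ofFn (e a) :=
    List.ofFn_injective.comp e.injective
  exact ⟨Function.invFun fun a => List.ofFn (e a), fun a =>
    ⟨List.ofFn (e a), by simp, Function.leftInverse_invFun hinj a⟩⟩

/-- Memory must hold the abstract state and an unfinished block of fewer than `b` bits. -/
theorem exists_state_code [Fintype M] [Nonempty M] {b m : ℕ}
    (hM : Fintype.card M * 2 ^ (2 * b) ≤ 2 ^ m) :
    ∃ (e : M × List Bool → (Fin m → Bool)) (d : (Fin m → Bool) → M × List Bool),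
      ∀ q, q.2.length < b → d (e q) = q := by
  obtain ⟨e⟩ : Nonempty (M × (Fin b → Option Bool) ↪ (Fin m → Bool)) := by
    apply Function.Embedding.nonempty_of_card_le
    -- Each of the `b` buffer slots is empty, `false` or `true`, hence `3 ^ b`.
    have h3 : 3 ^ b ≤ 2 ^ (2 * b) := by
      rw [pow_mul]; exact Nat.pow_le_pow_left (by norm_num) b
    simpa using (Nat.mul_le_mul_left (Fintype.card M) h3).trans hM
  let e' : M × List Bool → (Fin m → Bool) := fun q => e (q.1, fun i => q.2[i.1]?)
  have hinj : Set.InjOn e' {q | q.2.length < b} := by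
    rintro ⟨m₁, l₁⟩ h₁ ⟨m₂, l₂⟩ h₂ h
    have h' := e.injective h
    rw [Prod.mk.injEq] at h'
    refine Prod.ext h'.1 (List.ext_getElem? fun i => ?_)
    by_cases hi : i < b
    · exact congrFun h'.2 ⟨i, hi⟩
    · have h₁ : l₁.length < b := h₁
      have h₂ : l₂.length < b := h₂
      rw [List.getElem?_eq_none (by dsimp only; omega), List.getElem?_eq_none (by dsimp only; omega)]
  exact ⟨e', Function.invFunOn e' {q | q.2.length < b}, fun q hq => hinj.leftInvOn_invFunOn hq⟩

/-- A verifier with an arbitrary finite state space, reading help tokens of a finite type, yields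
a scheme. -/
theorem exists_computes_of_tokens [Fintype M] [Fintype T] [Nonempty T] {k m b N : ℕ}
    (hb : 0 < b) (hT : Fintype.card T ≤ 2 ^ b) (hM : Fintype.card M * 2 ^ (2 * b) ≤ 2 ^ m)
    (ini : (Fin k → Bool) → M) (rI : (Fin k → Bool) → M → α → M)
    (rH : (Fin k → Bool) → M → T → M) (dec : (Fin k → Bool) → M → Option β)
    (D : Set (List α)) (f : List α → β)
    (complete : ∀ σ ∈ D, ∃ w : List T, w.length ≤ N ∧
      ∀ R, dec R (w.foldl (rH R) (σ.foldl (rI R) (ini R))) = some (f σ))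
    (sound : ∀ σ ∈ D, ∀ w : List T, 3 * Nat.card {R : Fin k → Bool //
      dec R (w.foldl (rH R) (σ.foldl (rI R) (ini R))) ≠ some (f σ) ∧
      dec R (w.foldl (rH R) (σ.foldl (rI R) (ini R))) ≠ none} ≤ 2 ^ k) :
    ∃ S : StreamScheme α β, S.Computes D f (b * N) (k + m) := by
  have : Nonempty M := ⟨ini fun _ => true⟩
  obtain ⟨dT, hdT⟩ := exists_bit_decoder hT
  obtain ⟨e, d, hed⟩ := exists_state_code hM
  let S : StreamScheme α β :=
    { coins := k
      mem := m
      init := fun R => e (ini R, [])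
      readInput := fun R q a => e (rI R (d q).1 a, [])
      readHelp := fun R q x => e (bitStep b dT (rH R) (d q) x)
      decide := fun R q => dec R (d q).1 }
  have hsum (R) (σ : List α) : S.summary R σ = e (σ.foldl (rI R) (ini R), []) := by
    induction σ using List.reverseRecOn with
    | nil => rfl
    | append_singleton σ a ih =>
      simp only [summary, List.foldl_append, List.foldl_cons, List.foldl_nil] at ih ⊢
      rw [ih]
      simp only [S]
      rw [hed (_, []) hb]
  have hhelp (R) (H : List Bool) : ∀ q : M × List Bool, q.2.length < b →
      (H.foldl (bitStep b dT (rH R)) q).2.length < b ∧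
      H.foldl (S.readHelp R) (e q) = e (H.foldl (bitStep b dT (rH R)) q) := by
    induction H with
    | nil => intro q hq; exact ⟨hq, rfl⟩
    | cons x H ih =>
      intro q hq
      have h2 : S.readHelp R (e q) x = e (bitStep b dT (rH R) q x) := by
        simp only [S]; rw [hed _ hq]
      rw [List.foldl_cons, List.foldl_cons, h2]
      exact ih _ (bitStep_length dT (rH R) hq x)
  have hout (R) (σ : List α) (H : List Bool) : S.out R (S.summary R σ) H =
      dec R ((blockTokens b dT [] H).foldl (rH R) (σ.foldl (rI R) (ini R))) := by
    obtain ⟨h1, h2⟩ := hhelp R H (σ.foldl (rI R) (ini R), []) hb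
    rw [hsum, out, h2]
    change dec R (d (e _)).1 = _
    rw [hed _ h1, foldl_bitStep]
  refine ⟨S, le_rfl, fun σ hσ => ?_, fun σ hσ H => ?_⟩
  · obtain ⟨w, hw, hR⟩ := complete σ hσ
    obtain ⟨H, hH, rfl⟩ := exists_blockTokens_eq hb hdT w
    refine ⟨H, hH.le.trans (Nat.mul_le_mul_left b hw), ?_⟩
    have hall : ∀ R, S.out R (S.summary R σ) H = some (f σ) := fun R => by rw [hout, hR]
    simp only [prob, hall, Nat.card_eq_fintype_card, Fintype.card_subtype_true]
    simp
  · have h := sound σ hσ (blockTokens b dT [] H)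
    simp only [prob, hout]
    change (Nat.card {R : Fin k → Bool // _} : ℝ) / 2 ^ k ≤ 1 / 3
    rw [div_le_div_iff₀ (by positivity) (by norm_num)]
    rw [one_mul, mul_comm]
    exact_mod_cast h

end BitTokens

/-! ### Verifiers that add up contributions in a finite group -/

section Linear

variable {α β T G : Type} [AddCommGroup G]

/-- One step of an additive reader of `N` tokens; later tokens are ignored. -/
def countStep {N : ℕ} (hC : Fin N → T → G) (q : Fin (N + 1) × G) (a : T) : Fin (N + 1) × G :=
  if h : q.1.1 < N then (⟨q.1.1 + 1, by omega⟩, q.2 + hC ⟨q.1.1, h⟩ a) else q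

theorem foldl_countStep {N : ℕ} (hC : Fin N → T → G) (g : G) (w : List T) :
    ((w.foldl (countStep hC) (0, g)).1 : ℕ) = min w.length N ∧
    (w.foldl (countStep hC) (0, g)).2 = g + ∑ j : Fin N, (w[j.1]?).elim 0 (hC j) := by
  induction w using List.reverseRecOn with
  | nil => simp
  | append_singleton w a ih =>
    obtain ⟨h1, h2⟩ := ih
    rw [List.foldl_append, List.foldl_cons, List.foldl_nil]
    generalize w.foldl (countStep hC) (0, g) = q at h1 h2
    unfold countStep
    by_cases h : q.1.1 < N
    · have hq : q.1.1 = w.length := by omega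
      rw [dif_pos h]
      refine ⟨by simp; omega, ?_⟩
      simp only [h2, add_assoc]
      congr 1
      rw [← Finset.add_sum_erase _ _ (Finset.mem_univ (⟨q.1.1, h⟩ : Fin N)),
        ← Finset.add_sum_erase (a := (⟨q.1.1, h⟩ : Fin N))
          (f := fun j : Fin N => ((w ++ [a])[j.1]?).elim 0 (hC j)) _ (Finset.mem_univ _)]
      have e1 : w[q.1.1]? = none := List.getElem?_eq_none (by omega)
      have e2 : (w ++ [a])[q.1.1]? = some a := by rw [hq]; simp
      simp only [e1, e2, Option.elim]
      rw [zero_add, add_comm]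
      congr 1
      refine Finset.sum_congr rfl fun j hj => ?_
      have hj' : j.1 ≠ w.length := fun h' => (Finset.ne_of_mem_erase hj) (Fin.ext (by simp; omega))
      congr 1
      rcases lt_or_gt_of_ne hj' with h' | h'
      · rw [List.getElem?_append_left h']
      · rw [List.getElem?_eq_none (by omega), List.getElem?_eq_none (by simp; omega)]
    · rw [dif_neg h]
      refine ⟨by simp; omega, ?_⟩
      rw [h2]
      congr 1
      refine Finset.sum_congr rfl fun j _ => ?_
      rw [List.getElem?_append_left (by omega)]

/-- A verifier that only sums up contributions of the stream tokens and of `N` help tokens in a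
finite group yields a scheme. -/
theorem exists_computes_of_linear [Fintype G] [Fintype T] [Nonempty T] {k m b N : ℕ}
    (hb : 0 < b) (hT : Fintype.card T ≤ 2 ^ b)
    (hM : (N + 1) * Fintype.card G * 2 ^ (2 * b) ≤ 2 ^ m)
    (inC : (Fin k → Bool) → α → G) (hC : (Fin k → Bool) → Fin N → T → G)
    (dec : (Fin k → Bool) → G → Option β) (D : Set (List α)) (f : List α → β)
    (complete : ∀ σ ∈ D, ∃ w : Fin N → T, ∀ R,
      dec R ((σ.map (inC R)).sum + ∑ j, hC R j (w j)) = some (f σ))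
    (sound : ∀ σ ∈ D, ∀ w : Fin N → T, 3 * Nat.card {R : Fin k → Bool //
      dec R ((σ.map (inC R)).sum + ∑ j, hC R j (w j)) ≠ some (f σ) ∧
      dec R ((σ.map (inC R)).sum + ∑ j, hC R j (w j)) ≠ none} ≤ 2 ^ k) :
    ∃ S : StreamScheme α β, S.Computes D f (b * N) (k + m) := by
  have hI (R) (σ : List α) : σ.foldl (fun (q : Fin (N + 1) × G) a => (q.1, q.2 + inC R a)) (0, 0) =
      (0, (σ.map (inC R)).sum) := by
    induction σ using List.reverseRecOn with
    | nil => rfl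
    | append_singleton σ a ih => simp [List.foldl_append, ih]
  have hval (R) (g : G) (w : List T) (hw : N ≤ w.length) :
      w.foldl (countStep (hC R)) (0, g) =
        (Fin.last N, g + ∑ j : Fin N, hC R j (w[j.1]'(by omega))) := by
    obtain ⟨h1, h2⟩ := foldl_countStep (hC R) g w
    refine Prod.ext (Fin.ext (by simp [h1, hw])) ?_
    rw [h2]
    congr 1
    refine Finset.sum_congr rfl fun j _ => ?_
    rw [List.getElem?_eq_getElem (by omega)]
    rfl
  refine exists_computes_of_tokens (M := Fin (N + 1) × G) (N := N) hb hT (by simpa using hM)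
    (fun _ => (0, 0)) (fun R q a => (q.1, q.2 + inC R a)) (fun R => countStep (hC R))
    (fun R q => if q.1 = Fin.last N then dec R q.2 else none) D f
    (fun σ hσ => ?_) (fun σ hσ w => ?_)
  · obtain ⟨w, hw⟩ := complete σ hσ
    refine ⟨List.ofFn w, by simp, fun R => ?_⟩
    rw [hI, hval _ _ _ (by simp)]
    simpa using hw R
  · by_cases hw : N ≤ w.length
    · have h := sound σ hσ fun j => w[j.1]'(by omega)
      simp only [hI, hval _ _ _ hw, if_true]
      exact h
    -- A proof stream with fewer than `N` tokens leaves the counter short of `N`, which means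
    -- rejection.
    · have hne (R) : (w.foldl (countStep (hC R)) (0, (σ.map (inC R)).sum)).1 ≠ Fin.last N := by
        intro h'
        have h1 := (foldl_countStep (hC R) (σ.map (inC R)).sum w).1
        rw [h'] at h1
        simp at h1
        omega
      simp [hI, hne]

end Linear

end StreamScheme

/-! ### Spanning forest certificates and their violations -/

section Components

variable {n : ℕ}

theorem edgeMult_diag {σ : List (EdgeToken n)} (hσ : σ ∈ graphStreams n) (u : Fin n) :
    edgeMult σ s(u, u) = 0 := by
  rcases hσ s(u, u) with h | h
  · exact h
  · exact absurd (by simp) h.2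

theorem streamGraph_adj {σ : List (EdgeToken n)} (hσ : σ ∈ graphStreams n) (u v : Fin n) :
    (streamGraph σ).Adj u v ↔ edgeMult σ s(u, v) = 1 := by
  rw [streamGraph, SimpleGraph.fromEdgeSet_adj]
  refine ⟨fun h => h.1, fun h => ⟨h, ?_⟩⟩
  rintro rfl
  rw [edgeMult_diag hσ] at h
  exact zero_ne_one h

/-- `par`, `lab`, `dep` describe a spanning forest of `G`: labels are constant along edges, and
each vertex that is not its own label is adjacent to its parent, which has depth one less. -/
def IsForestCertificate (G : SimpleGraph (Fin n)) (par lab : Fin n → Fin n) (dep : Fin n → ℕ) :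
    Prop :=
  (∀ u v, G.Adj u v → lab u = lab v) ∧
    ∀ u, lab u ≠ u → G.Adj u (par u) ∧ dep u = dep (par u) + 1

/-- Constant labels allow at most one self-labelled vertex per component; climbing to parents
strictly lowers the depth, so it ends at such a vertex and each component has one. -/
theorem IsForestCertificate.card_components {G : SimpleGraph (Fin n)} {par lab : Fin n → Fin n}
    {dep : Fin n → ℕ} (h : IsForestCertificate G par lab dep) :
    Nat.card G.ConnectedComponent = (Finset.univ.filter fun v => lab v = v).card := by
  have hreach : ∀ u v, G.Reachable u v → lab u = lab v := by
    rintro u v ⟨p⟩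
    induction p with
    | nil => rfl
    | cons h' _ ih => exact (h.1 _ _ h').trans ih
  have hroot : ∀ d v, dep v = d → ∃ r, lab r = r ∧ G.Reachable r v := by
    intro d
    induction d with
    | zero =>
      intro v hv
      refine ⟨v, ?_, .refl v⟩
      by_contra hne
      have := (h.2 v hne).2
      omega
    | succ d ih =>
      intro v hv
      by_cases hne : lab v = v
      · exact ⟨v, hne, .refl v⟩
      · obtain ⟨hadj, hd⟩ := h.2 v hne
        obtain ⟨r, hr, hp⟩ := ih (par v) (by omega)
        exact ⟨r, hr, hp.trans hadj.symm.reachable⟩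
  rw [← Fintype.card_subtype, ← Nat.card_eq_fintype_card]
  refine (Nat.card_congr (Equiv.ofBijective
    (fun v : {v // lab v = v} => G.connectedComponentMk v.1) ⟨?_, ?_⟩)).symm
  · rintro ⟨u, hu⟩ ⟨v, hv⟩ huv
    have := hreach u v (SimpleGraph.ConnectedComponent.exact huv)
    rw [hu, hv] at this
    exact Subtype.ext this
  · intro c
    induction c using SimpleGraph.ConnectedComponent.ind with
    | h v =>
      obtain ⟨r, hr, hp⟩ := hroot _ v rfl
      exact ⟨⟨r, hr⟩, SimpleGraph.ConnectedComponent.sound hp⟩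

theorem exists_adj_dist_eq_succ {V : Type*} {G : SimpleGraph V} {v r : V} (h : G.Reachable v r)
    (hne : r ≠ v) : ∃ w, G.Adj v w ∧ G.dist v r = G.dist w r + 1 := by
  obtain ⟨p, hp⟩ := h.exists_walk_length_eq_dist
  cases p with
  | nil => exact absurd rfl hne
  | @cons _ w _ h q =>
    refine ⟨w, h, ?_⟩
    have h1 := SimpleGraph.dist_le q
    obtain ⟨q', hq'⟩ := q.reachable.exists_walk_length_eq_dist
    have h2 := SimpleGraph.dist_le (SimpleGraph.Walk.cons h q')
    simp only [SimpleGraph.Walk.length_cons] at hp h2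
    omega

/-- Take a representative of each component as label, the distance to it as depth, and the next
vertex on a shortest walk to it as parent. -/
theorem exists_isForestCertificate (G : SimpleGraph (Fin n)) :
    ∃ (par lab dep : Fin n → Fin n), IsForestCertificate G par lab fun v => (dep v).1 := by
  let lab : Fin n → Fin n := fun v => (G.connectedComponentMk v).out
  have hlab (v) : G.Reachable v (lab v) :=
    (SimpleGraph.ConnectedComponent.exact (Quot.out_eq (G.connectedComponentMk v))).symm
  have hadj (u v) (h : G.Adj u v) : lab u = lab v := by
    simp only [lab, SimpleGraph.ConnectedComponent.sound h.reachable]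
  have hlt (v) : G.dist v (lab v) < n := by
    obtain ⟨p, hp, hl⟩ := (hlab v).exists_path_of_dist
    rw [← hl]
    simpa using hp.length_lt
  have hpar (v) : ∃ w, lab v ≠ v → G.Adj v w ∧ G.dist v (lab v) = G.dist w (lab w) + 1 := by
    by_cases hne : lab v = v
    · exact ⟨v, fun h => absurd hne h⟩
    · obtain ⟨w, hw, hd⟩ := exists_adj_dist_eq_succ (hlab v) hne
      exact ⟨w, fun _ => ⟨hw, by rw [hd, hadj v w hw]⟩⟩
  choose par hpar using hpar
  exact ⟨par, lab, fun v => ⟨_, hlt v⟩, hadj, hpar⟩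

/-- The contribution of the pair `(u, v)` to the count of violations of a certificate. -/
def violation {R : Type*} [CommRing R] (a π l d : R) : R :=
  a * l ^ 2 + π * (1 - a + d ^ 2)

theorem map_violation {R S : Type*} [CommRing R] [CommRing S] (φ : R →+* S) (a π l d : R) :
    φ (violation a π l d) = violation (φ a) (φ π) (φ l) (φ d) := by
  simp [violation]

/-- The number of violations of a certificate at the pair `(u, v)`, weighted. -/
def pairViolation (σ : List (EdgeToken n)) (par lab dep : Fin n → Fin n) (u v : Fin n) : ℤ :=
  violation (edgeMult σ s(u, v)) (if lab u ≠ u ∧ par u = v then 1 else 0)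
    ((lab u : ℤ) - (lab v : ℤ)) ((dep u : ℤ) - 1 - (dep v : ℤ))

theorem pairViolation_bounds {σ : List (EdgeToken n)} (hσ : σ ∈ graphStreams n)
    (par lab dep : Fin n → Fin n) (u v : Fin n) :
    0 ≤ pairViolation σ par lab dep u v ∧
      pairViolation σ par lab dep u v ≤ 2 * (n : ℤ) ^ 2 + 1 := by
  have hl : ((lab u : ℤ) - (lab v : ℤ)) ^ 2 ≤ (n : ℤ) ^ 2 :=
    sq_le_sq' (by omega) (by omega)
  have hd : ((dep u : ℤ) - 1 - (dep v : ℤ)) ^ 2 ≤ (n : ℤ) ^ 2 :=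
    sq_le_sq' (by omega) (by omega)
  have hl0 := sq_nonneg ((lab u : ℤ) - (lab v : ℤ))
  have hd0 := sq_nonneg ((dep u : ℤ) - 1 - (dep v : ℤ))
  unfold pairViolation violation
  rcases hσ s(u, v) with h | h
  · rw [h]; split_ifs <;> constructor <;> linarith
  · rw [h.1]; split_ifs <;> constructor <;> linarith

/-- With multiplicities in `{0, 1}` both summands of a violation are nonnegative, so nothing
cancels. The first enforces equal labels across edges; the second enforces that the parent link is
an edge and that the depth drops by one. -/
theorem isForestCertificate_iff {σ : List (EdgeToken n)} (hσ : σ ∈ graphStreams n)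
    (par lab dep : Fin n → Fin n) :
    IsForestCertificate (streamGraph σ) par lab (fun v => (dep v).1) ↔
      ∀ u v, pairViolation σ par lab dep u v = 0 := by
  constructor
  · rintro ⟨h1, h2⟩ u v
    unfold pairViolation violation
    have e1 : edgeMult σ s(u, v) * ((lab u : ℤ) - (lab v : ℤ)) ^ 2 = 0 := by
      rcases hσ s(u, v) with h | h
      · rw [h, zero_mul]
      · rw [h1 u v ((streamGraph_adj hσ u v).2 h.1)]; simp
    rw [e1, zero_add]
    split_ifs with h
    · obtain ⟨hu, rfl⟩ := h
      obtain ⟨ha, hd⟩ := h2 u hu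
      rw [(streamGraph_adj hσ _ _).1 ha, show (dep u).1 = (dep (par u)).1 + 1 from hd]
      simp
    · simp
  · intro h0
    have key (u v) : edgeMult σ s(u, v) * ((lab u : ℤ) - (lab v : ℤ)) ^ 2 = 0 ∧
        (lab u ≠ u ∧ par u = v → edgeMult σ s(u, v) = 1 ∧
          ((dep u : ℤ) - 1 - (dep v : ℤ)) ^ 2 = 0) := by
      have h := h0 u v
      have hl0 := sq_nonneg ((lab u : ℤ) - (lab v : ℤ))
      have hd0 := sq_nonneg ((dep u : ℤ) - 1 - (dep v : ℤ))
      unfold pairViolation violation at h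
      rcases hσ s(u, v) with ha | ⟨ha, -⟩ <;> rw [ha] at h ⊢
      · refine ⟨zero_mul _, fun hc => ?_⟩
        rw [if_pos hc] at h
        linarith
      · split_ifs at h with hc
        · exact ⟨by linarith, fun _ => ⟨rfl, by linarith⟩⟩
        · exact ⟨by linarith, fun hc' => absurd hc' hc⟩
    refine ⟨fun u v huv => ?_, fun u hu => ?_⟩
    · have h := (key u v).1
      rw [(streamGraph_adj hσ u v).1 huv, one_mul] at h
      have h' := pow_eq_zero_iff (two_ne_zero) |>.1 h
      exact Fin.ext (by omega)
    · obtain ⟨h1, h2⟩ := (key u (par u)).2 ⟨hu, rfl⟩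
      have h' := pow_eq_zero_iff (two_ne_zero) |>.1 h2
      exact ⟨(streamGraph_adj hσ _ _).2 h1, by simp only; omega⟩

/-- The integer sum is nonnegative and less than `p`, so vanishing mod `p` makes it zero, and then
every term is zero. -/
theorem isForestCertificate_of_sum_eq_zero {p : ℕ} (hp : n ^ 2 * (2 * n ^ 2 + 1) < p)
    {σ : List (EdgeToken n)} (hσ : σ ∈ graphStreams n) (par lab dep : Fin n → Fin n)
    (h : ∑ u, ∑ v, (pairViolation σ par lab dep u v : ZMod p) = 0) :
    IsForestCertificate (streamGraph σ) par lab (fun v => (dep v).1) := by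
  have hnn (u v) := (pairViolation_bounds hσ par lab dep u v).1
  have hz : ∑ u, ∑ v, pairViolation σ par lab dep u v = 0 := by
    have hdvd : (p : ℤ) ∣ ∑ u, ∑ v, pairViolation σ par lab dep u v := by
      rw [← ZMod.intCast_zmod_eq_zero_iff_dvd]
      push_cast
      exact h
    refine Int.eq_zero_of_dvd_of_nonneg_of_lt
      (Finset.sum_nonneg fun u _ => Finset.sum_nonneg fun v _ => hnn u v) ?_ hdvd
    calc ∑ u, ∑ v, pairViolation σ par lab dep u v
        ≤ ∑ _u : Fin n, ∑ _v : Fin n, (2 * (n : ℤ) ^ 2 + 1) :=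
          Finset.sum_le_sum fun u _ => Finset.sum_le_sum fun v _ =>
            (pairViolation_bounds hσ par lab dep u v).2
      _ = ((n ^ 2 * (2 * n ^ 2 + 1) : ℕ) : ℤ) := by simp; ring
      _ < p := by exact_mod_cast hp
  refine (isForestCertificate_iff hσ par lab dep).2 fun u v => ?_
  have h1 := (Finset.sum_eq_zero_iff_of_nonneg
    fun u _ => Finset.sum_nonneg fun v _ => hnn u v).1 hz u (Finset.mem_univ u)
  exact (Finset.sum_eq_zero_iff_of_nonneg fun v _ => hnn u v).1 h1 v (Finset.mem_univ v)

end Components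

open Polynomial

/-! ### Low-degree extensions of matrices over a grid -/

section Extension

variable {F : Type} [Field F] {n t s : ℕ}

/-- Vertex `v` is placed at `z v` in a `t × s` grid. The entries `M u v` with `v` in the column `j`
are the values of the polynomial `columnPoly z node M j` at the points `node (u, (z v).1)`. -/
noncomputable def columnPoly (z : Fin n → Fin t × Fin s) (node : Fin n × Fin t → F)
    (M : Fin n → Fin n → F) (j : Fin s) : F[X] :=
  ∑ u, ∑ v, if (z v).2 = j then C (M u v) * Lagrange.basis Finset.univ node (u, (z v).1) else 0

theorem columnPoly_natDegree (z : Fin n → Fin t × Fin s) {node : Fin n × Fin t → F}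
    (hnode : Function.Injective node) (M : Fin n → Fin n → F) (j : Fin s) :
    (columnPoly z node M j).natDegree ≤ n * t - 1 := by
  refine natDegree_sum_le_of_forall_le _ _ fun u _ => natDegree_sum_le_of_forall_le _ _ fun v _ => ?_
  split_ifs
  · refine (natDegree_C_mul_le _ _).trans (natDegree_le_of_degree_le ?_)
    rw [Lagrange.degree_basis hnode.injOn (Finset.mem_univ _)]
    simp
  · simp

theorem columnPoly_eval_node {z : Fin n → Fin t × Fin s} {node : Fin n × Fin t → F}
    (hnode : Function.Injective node) (M : Fin n → Fin n → F) (j : Fin s) (u : Fin n)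
    (i : Fin t) :
    (columnPoly z node M j).eval (node (u, i)) = ∑ v, if z v = (i, j) then M u v else 0 := by
  simp only [columnPoly, eval_finsetSum]
  rw [Finset.sum_eq_single u]
  · refine Finset.sum_congr rfl fun v _ => ?_
    by_cases hj : (z v).2 = j
    · rw [if_pos hj, eval_mul, eval_C]
      by_cases hi : (z v).1 = i
      · rw [if_pos (Prod.ext hi hj), hi, Lagrange.eval_basis_self hnode.injOn (Finset.mem_univ _),
          mul_one]
      · rw [if_neg (fun h => hi (by rw [h])), Lagrange.eval_basis_of_ne (by simpa using hi)
          (Finset.mem_univ _), mul_zero]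
    · rw [if_neg hj, if_neg (fun h => hj (by rw [h])), eval_zero]
  · intro u' _ hu
    refine Finset.sum_eq_zero fun v _ => ?_
    split_ifs
    · rw [eval_mul, Lagrange.eval_basis_of_ne (by simp [hu]) (Finset.mem_univ _), mul_zero]
    · simp
  · simp

theorem columnPoly_add (z : Fin n → Fin t × Fin s) (node : Fin n × Fin t → F)
    (M M' : Fin n → Fin n → F) (j : Fin s) :
    columnPoly z node (M + M') j = columnPoly z node M j + columnPoly z node M' j := by
  simp only [columnPoly, ← Finset.sum_add_distrib]
  refine Finset.sum_congr rfl fun u _ => Finset.sum_congr rfl fun v _ => ?_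
  split_ifs
  · simp [add_mul]
  · simp

/-- The polynomial whose values at all nodes add up to the count of violations. -/
noncomputable def violationPoly (z : Fin n → Fin t × Fin s) (node : Fin n × Fin t → F)
    (A B L E : Fin n → Fin n → F) : F[X] :=
  ∑ j, violation (columnPoly z node A j) (columnPoly z node B j) (columnPoly z node L j)
    (columnPoly z node E j)

theorem violationPoly_natDegree (z : Fin n → Fin t × Fin s) {node : Fin n × Fin t → F}
    (hnode : Function.Injective node) (A B L E : Fin n → Fin n → F) :
    (violationPoly z node A B L E).natDegree ≤ 3 * (n * t - 1) := by
  have hc (M j) := columnPoly_natDegree z hnode M j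
  refine natDegree_sum_le_of_forall_le _ _ fun j _ => ?_
  have hsq (M) : (columnPoly z node M j ^ 2).natDegree ≤ 2 * (n * t - 1) :=
    natDegree_pow_le.trans (Nat.mul_le_mul_left 2 (hc M j))
  refine (natDegree_add_le _ _).trans (max_le ?_ ?_)
  · refine natDegree_mul_le.trans ?_
    have h1 := hc A j
    have h2 := hsq L
    omega
  · refine natDegree_mul_le.trans ?_
    have h1 := hc B j
    have h2 : (1 - columnPoly z node A j + columnPoly z node E j ^ 2).natDegree
        ≤ 2 * (n * t - 1) := by
      refine (natDegree_add_le _ _).trans (max_le ((natDegree_sub_le _ _).trans ?_) (hsq E))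
      have := hc A j
      simp only [natDegree_one, zero_le, sup_of_le_right]
      omega
    omega

theorem sum_violationPoly_eval {z : Fin n → Fin t × Fin s} (hz : Function.Injective z)
    {node : Fin n × Fin t → F} (hnode : Function.Injective node) (A B L E : Fin n → Fin n → F) :
    ∑ i, (violationPoly z node A B L E).eval (node i) =
      ∑ u, ∑ v, violation (A u v) (B u v) (L u v) (E u v) := by
  rw [Fintype.sum_prod_type]
  refine Finset.sum_congr rfl fun u _ => ?_
  simp only [violationPoly, eval_finsetSum]
  have hev (i : Fin t) (j : Fin s) : (violation (columnPoly z node A j) (columnPoly z node B j)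
      (columnPoly z node L j) (columnPoly z node E j)).eval (node (u, i)) =
      violation (∑ v, if z v = (i, j) then A u v else 0) (∑ v, if z v = (i, j) then B u v else 0)
        (∑ v, if z v = (i, j) then L u v else 0) (∑ v, if z v = (i, j) then E u v else 0) := by
    rw [← coe_evalRingHom, map_violation]
    simp only [coe_evalRingHom, columnPoly_eval_node hnode]
  simp only [hev]
  rw [← Fintype.sum_prod_type' (f := fun i j =>
    violation (∑ v, if z v = (i, j) then A u v else 0) (∑ v, if z v = (i, j) then B u v else 0)
        (∑ v, if z v = (i, j) then L u v else 0) (∑ v, if z v = (i, j) then E u v else 0))]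
  symm
  refine Fintype.sum_of_injective z hz _ _ (fun q hq => ?_) (fun v => ?_)
  -- Unoccupied grid cells hold zeros in all four matrices, and the violation of zeros is zero.
  · have (v : Fin n) : z v ≠ q := fun h => hq ⟨v, h⟩
    simp [this, violation]
  · simp [hz.eq_iff]

end Extension

/-! ### Verifier's linear sketch -/

section Sketch

variable {F : Type} [Field F] {n t s : ℕ}

/-- Values that Verifier would like to collect: the adjacency matrix, the parent matrix, the
matrices of label and depth differences, the prover's polynomial and the number of roots. -/
abbrev FullData (F : Type) [Field F] (n : ℕ) : Type :=
  (Fin n → Fin n → F) × (Fin n → Fin n → F) × (Fin n → Fin n → F) × (Fin n → Fin n → F) × F[X] × F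

/-- The part of `FullData` that Verifier keeps. -/
abbrev SketchData (F : Type) (s : ℕ) : Type :=
  (Fin s → F) × (Fin s → F) × (Fin s → F) × (Fin s → F) × F × F × F

/-- The linear sketch that Verifier keeps, for the random point `r`. -/
noncomputable def sketch (z : Fin n → Fin t × Fin s) (node : Fin n × Fin t → F) (r : F) :
    FullData F n →+ SketchData F s :=
  AddMonoidHom.mk' (fun q =>
    (fun j => (columnPoly z node q.1 j).eval r,
      fun j => (columnPoly z node q.2.1 j).eval r,
      fun j => (columnPoly z node q.2.2.1 j).eval r,
      fun j => (columnPoly z node q.2.2.2.1 j).eval r,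
      q.2.2.2.2.1.eval r, ∑ i, q.2.2.2.2.1.eval (node i), q.2.2.2.2.2)) (by
    intro q q'
    simp only [Prod.fst_add, Prod.snd_add, columnPoly_add, eval_add, Finset.sum_add_distrib]
    rfl)

/-- Verifier accepts if the polynomial sent by the prover agrees with the violation polynomial at
the random point and its values at the nodes add up to zero. -/
def SketchAccepts (q : SketchData F s) : Prop :=
  q.2.2.2.2.1 = ∑ j, violation (q.1 j) (q.2.1 j) (q.2.2.1 j) (q.2.2.2.1 j) ∧ q.2.2.2.2.2.1 = 0

theorem sketchAccepts_iff (z : Fin n → Fin t × Fin s) (node : Fin n × Fin t → F) (r : F)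
    (A B L E : Fin n → Fin n → F) (P : F[X]) (c : F) :
    SketchAccepts (sketch z node r (A, B, L, E, P, c)) ↔
      P.eval r = (violationPoly z node A B L E).eval r ∧ ∑ i, P.eval (node i) = 0 := by
  have h : (violationPoly z node A B L E).eval r = ∑ j, violation
      ((columnPoly z node A j).eval r) ((columnPoly z node B j).eval r)
      ((columnPoly z node L j).eval r) ((columnPoly z node E j).eval r) := by
    simp only [violationPoly, eval_finsetSum]
    refine Finset.sum_congr rfl fun j _ => ?_
    simp only [← coe_evalRingHom, map_violation]
  rw [h]
  rfl

end Sketch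

/-! ### Additive contributions of input and help tokens -/

section Tokens

variable {n N : ℕ}

/-- A help token: parent, label and depth of a vertex, and a coefficient of a polynomial. -/
abbrev HelpToken (F : Type) (n : ℕ) : Type := Fin n × Fin n × Fin n × F

/-- The contribution of an input token. -/
noncomputable def inputData (F : Type) [Field F] (τ : EdgeToken n) : FullData F n :=
  (fun u v => if s(τ.1, τ.2.1) = s(u, v) then (τ.2.2 : F) else 0, 0, 0, 0, 0, 0)

/-- The contribution of the `j`th help token. -/
noncomputable def helpData {F : Type} [Field F] (j : Fin N) (a : HelpToken F n) : FullData F n :=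
  (0,
    fun u v => if u.1 = j.1 then (if a.2.1 ≠ u ∧ a.1 = v then 1 else 0) else 0,
    fun u v => (if u.1 = j.1 then ((a.2.1 : ℕ) : F) else 0) -
      (if v.1 = j.1 then ((a.2.1 : ℕ) : F) else 0),
    fun u v => (if u.1 = j.1 then ((a.2.2.1 : ℕ) : F) - 1 else 0) -
      (if v.1 = j.1 then ((a.2.2.1 : ℕ) : F) else 0),
    monomial j.1 a.2.2.2,
    ∑ u : Fin n, if u.1 = j.1 then (if a.2.1 = u then 1 else 0) else 0)

theorem sum_inputData (F : Type) [Field F] (σ : List (EdgeToken n)) :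
    (σ.map (inputData F)).sum = (fun u v => (edgeMult σ s(u, v) : F), 0, 0, 0, 0, 0) := by
  induction σ with
  | nil => simp [edgeMult]; rfl
  | cons τ σ ih =>
    rw [List.map_cons, List.sum_cons, ih]
    simp only [inputData, Prod.mk_add_mk, add_zero, edgeMult, List.map_cons, List.sum_cons,
      Int.cast_add]
    congr 1
    funext u v
    simp

/-- A difference matrix is additive over vertices: the token of a vertex adds to its row and
subtracts from its column. Tokens with index at least `n` match no vertex and contribute only a
coefficient. -/
theorem sum_helpData {F : Type} [Field F] (hN : n ≤ N) (w : Fin N → HelpToken F n) :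
    ∑ j, helpData j (w j) =
      (0,
        fun u v => if (w (u.castLE hN)).2.1 ≠ u ∧ (w (u.castLE hN)).1 = v then 1 else 0,
        fun u v => (((w (u.castLE hN)).2.1 : ℕ) : F) - (((w (v.castLE hN)).2.1 : ℕ) : F),
        fun u v => (((w (u.castLE hN)).2.2.1 : ℕ) : F) - 1 -
          (((w (v.castLE hN)).2.2.1 : ℕ) : F),
        ∑ j : Fin N, monomial j.1 (w j).2.2.2,
        ((Finset.univ.filter fun u : Fin n => (w (u.castLE hN)).2.1 = u).card : F)) := by
  have hcast (u : Fin n) (j : Fin N) : (u.1 = j.1) = (u.castLE hN = j) := by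
    rw [Fin.ext_iff]; rfl
  refine Prod.ext ?_ (Prod.ext ?_ (Prod.ext ?_ (Prod.ext ?_ (Prod.ext ?_ ?_))))
  · simp [helpData, Prod.fst_sum]
  · funext u v
    simp [helpData, Prod.fst_sum, Prod.snd_sum, hcast]
  · funext u v
    simp [helpData, Prod.fst_sum, Prod.snd_sum, hcast]
  · funext u v
    simp [helpData, Prod.fst_sum, Prod.snd_sum, hcast]
  · simp [helpData, Prod.fst_sum, Prod.snd_sum]
  · simp only [helpData, Prod.snd_sum, hcast]
    rw [Finset.sum_comm]
    simp

end Tokens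

/-! ### Completeness and soundness of the polynomial check -/

section Verifier

variable {n t s N p : ℕ} [Fact p.Prime]

/-- Everything that the input and the help tokens contribute together. -/
noncomputable def totalData (p : ℕ) [Fact p.Prime] (σ : List (EdgeToken n))
    (w : Fin N → HelpToken (ZMod p) n) : FullData (ZMod p) n :=
  (σ.map (inputData (ZMod p))).sum + ∑ j, helpData j (w j)

/-- The violation polynomial of the certificate contained in the help tokens. -/
noncomputable def certificatePoly (z : Fin n → Fin t × Fin s) (node : Fin n × Fin t → ZMod p)
    (σ : List (EdgeToken n)) (w : Fin N → HelpToken (ZMod p) n) : (ZMod p)[X] :=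
  violationPoly z node (totalData p σ w).1 (totalData p σ w).2.1 (totalData p σ w).2.2.1
    (totalData p σ w).2.2.2.1

theorem certificatePoly_eq (z : Fin n → Fin t × Fin s) (node : Fin n × Fin t → ZMod p)
    (hN : n ≤ N) (σ : List (EdgeToken n)) (w : Fin N → HelpToken (ZMod p) n) :
    certificatePoly z node σ w = violationPoly z node
      (fun u v => (edgeMult σ s(u, v) : ZMod p))
      (fun u v => if (w (u.castLE hN)).2.1 ≠ u ∧ (w (u.castLE hN)).1 = v then 1 else 0)
      (fun u v => (((w (u.castLE hN)).2.1 : ℕ) : ZMod p) - (((w (v.castLE hN)).2.1 : ℕ) : ZMod p))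
      (fun u v => (((w (u.castLE hN)).2.2.1 : ℕ) : ZMod p) - 1 -
        (((w (v.castLE hN)).2.2.1 : ℕ) : ZMod p)) := by
  rw [certificatePoly, totalData, sum_inputData, sum_helpData hN]
  simp only [Prod.mk_add_mk, add_zero, zero_add]

theorem sum_certificatePoly_eval {z : Fin n → Fin t × Fin s} (hz : Function.Injective z)
    {node : Fin n × Fin t → ZMod p} (hnode : Function.Injective node) (hN : n ≤ N)
    (σ : List (EdgeToken n)) (w : Fin N → HelpToken (ZMod p) n) :
    ∑ i, (certificatePoly z node σ w).eval (node i) = ∑ u, ∑ v,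
      (pairViolation σ (fun u => (w (u.castLE hN)).1) (fun u => (w (u.castLE hN)).2.1)
        (fun u => (w (u.castLE hN)).2.2.1) u v : ZMod p) := by
  rw [certificatePoly_eq z node hN, sum_violationPoly_eval hz hnode]
  refine Finset.sum_congr rfl fun u _ => Finset.sum_congr rfl fun v _ => ?_
  refine Eq.trans ?_ (map_violation (Int.castRingHom (ZMod p)) _ _ _ _).symm
  simp

theorem totalData_count (hN : n ≤ N) (σ : List (EdgeToken n))
    (w : Fin N → HelpToken (ZMod p) n) : (totalData p σ w).2.2.2.2.2 =
      ((Finset.univ.filter fun u : Fin n => (w (u.castLE hN)).2.1 = u).card : ZMod p) := by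
  rw [totalData, sum_inputData, sum_helpData hN]
  simp

theorem totalData_poly (hN : n ≤ N) (σ : List (EdgeToken n))
    (w : Fin N → HelpToken (ZMod p) n) :
    (totalData p σ w).2.2.2.2.1 = ∑ j : Fin N, monomial j.1 (w j).2.2.2 := by
  rw [totalData, sum_inputData, sum_helpData hN]
  simp

theorem certificatePoly_natDegree (z : Fin n → Fin t × Fin s) {node : Fin n × Fin t → ZMod p}
    (hnode : Function.Injective node) (h0 : 0 < N) (hN : 3 * (n * t) ≤ N)
    (σ : List (EdgeToken n)) (w : Fin N → HelpToken (ZMod p) n) :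
    (certificatePoly z node σ w).natDegree < N := by
  have := violationPoly_natDegree z hnode (totalData p σ w).1 (totalData p σ w).2.1
    (totalData p σ w).2.2.1 (totalData p σ w).2.2.2.1
  rw [certificatePoly]
  omega

/-- Verifier knows the count only mod `p`; being at most `n < p`, it is recovered exactly. -/
theorem count_eq_componentCount (hN : n ≤ N) (hp : n ^ 2 * (2 * n ^ 2 + 1) < p)
    {σ : List (EdgeToken n)} (w : Fin N → HelpToken (ZMod p) n)
    (h : IsForestCertificate (streamGraph σ) (fun u => (w (u.castLE hN)).1)
      (fun u => (w (u.castLE hN)).2.1) (fun u => ((w (u.castLE hN)).2.2.1).1)) :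
    ((totalData p σ w).2.2.2.2.2).val = componentCount σ := by
  rw [componentCount, h.card_components, totalData_count hN, ZMod.val_natCast_of_lt]
  refine (Finset.card_filter_le _ _).trans_lt (lt_of_le_of_lt ?_ hp)
  simp only [Finset.card_univ, Fintype.card_fin]
  nlinarith [Nat.zero_le (n ^ 4)]

open Classical in
/-- Verifier's output. -/
noncomputable def sketchOutput (q : SketchData (ZMod p) s) : Option ℕ :=
  if SketchAccepts q then some (q.2.2.2.2.2.2).val else none

theorem sketchOutput_of_accepts (z : Fin n → Fin t × Fin s) (node : Fin n × Fin t → ZMod p)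
    (r : ZMod p) (q : FullData (ZMod p) n) (h : SketchAccepts (sketch z node r q)) :
    sketchOutput (sketch z node r q) = some (q.2.2.2.2.2).val :=
  if_pos h

theorem sketchAccepts_totalData (z : Fin n → Fin t × Fin s) (node : Fin n × Fin t → ZMod p)
    (r : ZMod p) (σ : List (EdgeToken n)) (w : Fin N → HelpToken (ZMod p) n) :
    SketchAccepts (sketch z node r (totalData p σ w)) ↔
      (totalData p σ w).2.2.2.2.1.eval r = (certificatePoly z node σ w).eval r ∧
        ∑ i, (totalData p σ w).2.2.2.2.1.eval (node i) = 0 :=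
  sketchAccepts_iff z node r _ _ _ _ _ (totalData p σ w).2.2.2.2.2

/-- The help tokens for a certificate together with the coefficients of a polynomial. -/
def helpTokens {F : Type} [Field F] (h0 : 0 < n) (par lab dep : Fin n → Fin n) (P : F[X])
    (j : Fin N) : HelpToken F n :=
  let u : Fin n := if h : j.1 < n then ⟨j.1, h⟩ else ⟨0, h0⟩
  (par u, lab u, dep u, P.coeff j.1)

theorem exists_accepted_helpTokens {z : Fin n → Fin t × Fin s} (hz : Function.Injective z)
    {node : Fin n × Fin t → ZMod p} (hnode : Function.Injective node) (h0 : 0 < n)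
    (hN : n ≤ N) (hN3 : 3 * (n * t) ≤ N) (hp : n ^ 2 * (2 * n ^ 2 + 1) < p)
    {σ : List (EdgeToken n)} (hσ : σ ∈ graphStreams n) :
    ∃ w : Fin N → HelpToken (ZMod p) n, ∀ r : ZMod p,
      sketchOutput (sketch z node r (totalData p σ w)) = some (componentCount σ) := by
  obtain ⟨par, lab, dep, hc⟩ := exists_isForestCertificate (streamGraph σ)
  obtain ⟨Q, hQ0⟩ : ∃ Q : (ZMod p)[X],
      Q = certificatePoly z node σ (helpTokens (N := N) h0 par lab dep 0) := ⟨_, rfl⟩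
  obtain ⟨w, hw⟩ : ∃ w : Fin N → HelpToken (ZMod p) n,
      w = helpTokens h0 par lab dep Q := ⟨_, rfl⟩
  have hdata (P : (ZMod p)[X]) (u : Fin n) :
      helpTokens (N := N) h0 par lab dep P (u.castLE hN) = (par u, lab u, dep u, P.coeff u.1) := by
    simp [helpTokens]
  have hQ : certificatePoly z node σ w = Q := by
    simp only [hQ0, hw, certificatePoly_eq z node hN, hdata]
  have hcoeff (j : Fin N) : (w j).2.2.2 = Q.coeff j.1 := by
    simp only [hw, helpTokens]
  have hP : (totalData p σ w).2.2.2.2.1 = Q := by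
    have hQN : Q.natDegree < N :=
      hQ0 ▸ certificatePoly_natDegree z hnode (by omega) hN3 σ _
    rw [totalData_poly hN, Q.as_sum_range' N hQN,
      ← Fin.sum_univ_eq_sum_range (fun i => monomial i (Q.coeff i))]
    simp only [hcoeff]
  have hcert : IsForestCertificate (streamGraph σ) (fun u => (w (u.castLE hN)).1)
      (fun u => (w (u.castLE hN)).2.1) (fun u => ((w (u.castLE hN)).2.2.1).1) := by
    simpa only [hw, hdata] using hc
  refine ⟨w, fun r => ?_⟩
  rw [sketchOutput_of_accepts, count_eq_componentCount hN hp w hcert]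
  · rw [sketchAccepts_totalData, hP, hQ]
    refine ⟨rfl, ?_⟩
    rw [← hQ, sum_certificatePoly_eval hz hnode hN]
    refine Finset.sum_eq_zero fun u _ => Finset.sum_eq_zero fun v _ => ?_
    rw [(isForestCertificate_iff hσ _ _ _).1 hcert u v, Int.cast_zero]

/-- If `P = Q`, acceptance forces a valid certificate and hence the right output. Otherwise a
fooling point is a root of the nonzero polynomial `P - Q`, of degree at most `N`. The tokens `w` are
fixed before `R` is counted, as Prover does not see the coins. -/
theorem card_fooling_points {z : Fin n → Fin t × Fin s} (hz : Function.Injective z)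
    {node : Fin n × Fin t → ZMod p} (hnode : Function.Injective node) (h0 : 0 < N)
    (hN : n ≤ N) (hN3 : 3 * (n * t) ≤ N) (hp : n ^ 2 * (2 * n ^ 2 + 1) < p)
    {σ : List (EdgeToken n)} (hσ : σ ∈ graphStreams n) (w : Fin N → HelpToken (ZMod p) n)
    {Ω : Type} (r : Ω → ZMod p) (hr : Function.Injective r) :
    Nat.card {R : Ω //
      sketchOutput (sketch z node (r R) (totalData p σ w)) ≠ some (componentCount σ) ∧
      sketchOutput (sketch z node (r R) (totalData p σ w)) ≠ none} ≤ N := by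
  let P := (totalData p σ w).2.2.2.2.1
  let Q := certificatePoly z node σ w
  have key (R : Ω)
      (h : sketchOutput (sketch z node (r R) (totalData p σ w)) ≠ some (componentCount σ) ∧
        sketchOutput (sketch z node (r R) (totalData p σ w)) ≠ none) :
      r R ∈ (P - Q).roots.toFinset := by
    obtain ⟨h1, h2⟩ := h
    have hacc : SketchAccepts (sketch z node (r R) (totalData p σ w)) := by
      by_contra hn
      exact h2 (if_neg hn)
    rw [sketchOutput_of_accepts z node _ _ hacc] at h1
    obtain ⟨h3, h4⟩ := (sketchAccepts_totalData z node (r R) σ w).1 hacc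
    have hPQ : P ≠ Q := by
      intro hPQ
      apply h1
      change ∑ i, P.eval (node i) = 0 at h4
      rw [hPQ, sum_certificatePoly_eval hz hnode hN] at h4
      exact congrArg some (count_eq_componentCount hN hp w
        (isForestCertificate_of_sum_eq_zero hp hσ _ _ _ h4))
    rw [Multiset.mem_toFinset, mem_roots (sub_ne_zero.2 hPQ), IsRoot, eval_sub]
    exact sub_eq_zero.2 h3
  have hdeg : (P - Q).natDegree ≤ N := by
    refine (natDegree_sub_le _ _).trans (max_le ?_
      (certificatePoly_natDegree z hnode h0 hN3 σ w).le)
    simp only [P]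
    rw [totalData_poly hN]
    exact natDegree_sum_le_of_forall_le _ _ fun j _ => (natDegree_monomial_le _).trans j.2.le
  calc _ ≤ Nat.card {x // x ∈ (P - Q).roots.toFinset} :=
        Nat.card_le_card_of_injective (fun R => ⟨r R.1, key R.1 R.2⟩) fun R R' h =>
          Subtype.ext (hr (congrArg Subtype.val h))
    _ = (P - Q).roots.toFinset.card := by
      rw [Nat.card_eq_fintype_card, Fintype.card_coe]
    _ ≤ N := (Multiset.toFinset_card_le _).trans ((card_roots' _).trans hdeg)

end Verifier

/-! ### Assembling the scheme and choosing parameters -/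

theorem exists_grid {n t s : ℕ} (h : n ≤ t * s) :
    ∃ z : Fin n → Fin t × Fin s, Function.Injective z := by
  obtain ⟨e⟩ : Nonempty (Fin n ↪ Fin t × Fin s) :=
    Function.Embedding.nonempty_of_card_le (by simpa using h)
  exact ⟨e, e.injective⟩

theorem exists_componentScheme {n t s p k b m : ℕ} [Fact p.Prime] (hn : 0 < n) (ht : 0 < t)
    (hts : n ≤ t * s) (hp : n ^ 2 * (2 * n ^ 2 + 1) < p) (hnode : n * t ≤ p)
    (hkp : 2 ^ k ≤ p) (hk : 3 * (3 * (n * t)) ≤ 2 ^ k) (hb : 0 < b)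
    (hT : n * (n * (n * p)) ≤ 2 ^ b)
    (hM : (3 * (n * t) + 1) * p ^ (4 * s + 3) * 2 ^ (2 * b) ≤ 2 ^ m) :
    ∃ S : StreamScheme (EdgeToken n) ℕ,
      S.Computes (graphStreams n) componentCount (b * (3 * (n * t))) (k + m) := by
  obtain ⟨z, hz⟩ := exists_grid hts
  obtain ⟨node⟩ : Nonempty (Fin n × Fin t ↪ ZMod p) :=
    Function.Embedding.nonempty_of_card_le (by simpa [ZMod.card] using hnode)
  obtain ⟨r⟩ : Nonempty ((Fin k → Bool) ↪ ZMod p) :=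
    Function.Embedding.nonempty_of_card_le (by simpa [ZMod.card] using hkp)
  have : Nonempty (HelpToken (ZMod p) n) := ⟨(⟨0, hn⟩, ⟨0, hn⟩, ⟨0, hn⟩, 0)⟩
  have hN : n ≤ 3 * (n * t) := by nlinarith
  have htotal (R : Fin k → Bool) (σ : List (EdgeToken n))
      (w : Fin (3 * (n * t)) → HelpToken (ZMod p) n) :
      (σ.map fun τ => sketch z node (r R) (inputData (ZMod p) τ)).sum +
        ∑ j, sketch z node (r R) (helpData j (w j)) =
      sketch z node (r R) (totalData p σ w) := by
    rw [totalData, map_add, map_sum, map_list_sum, List.map_map]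
    rfl
  refine StreamScheme.exists_computes_of_linear (T := HelpToken (ZMod p) n)
    (G := SketchData (ZMod p) s) hb
    (by simpa [ZMod.card] using hT) (le_of_eq_of_le ?_ hM)
    (fun R τ => sketch z node (r R) (inputData (ZMod p) τ))
    (fun R j a => sketch z node (r R) (helpData j a)) (fun _ => sketchOutput) _ _
    (fun σ hσ => ?_) (fun σ hσ w => ?_)
  · simp only [Fintype.card_prod, Fintype.card_fun, ZMod.card, Fintype.card_fin]
    ring
  · obtain ⟨w, hw⟩ := exists_accepted_helpTokens hz node.injective hn hN le_rfl hp hσ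
    exact ⟨w, fun R => by rw [htotal]; exact hw _⟩
  · simp only [htotal]
    exact (Nat.mul_le_mul_left 3
      (card_fooling_points hz node.injective (by omega) hN le_rfl hp hσ w r r.injective)).trans hk

theorem exists_componentScheme_zero (h v : ℕ) :
    ∃ S : StreamScheme (EdgeToken 0) ℕ, S.Computes (graphStreams 0) componentCount h v := by
  let S : StreamScheme (EdgeToken 0) ℕ := ⟨0, 0, fun _ => 0, fun _ q _ => q, fun _ q _ => q,
    fun _ _ => some 0⟩
  have hout (R q H) (σ : List (EdgeToken 0)) : S.out R q H = some (componentCount σ) := by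
    simp [S, StreamScheme.out, componentCount]
  refine ⟨S, by simp [S, StreamScheme.vcost], fun σ _ => ⟨[], by simp, ?_⟩, fun σ _ H => ?_⟩
  · simp [StreamScheme.prob, hout _ _ _ σ]; simp [S]
  · simp [StreamScheme.prob, hout _ _ _ σ]

theorem mainTheorem10 :
    ∃ C k : ℕ, ∀ n t s : ℕ, 0 < t → 0 < s → n ≤ t * s →
      ∃ S : StreamScheme (EdgeToken n) ℕ,
        S.Computes (graphStreams n) componentCount
          (C * (n * t) * (Nat.log 2 n + 1) ^ k) (C * s * (Nat.log 2 n + 1) ^ k) := by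
  refine ⟨200, 1, fun n t s ht hs hts => ?_⟩
  rcases Nat.eq_zero_or_pos n with rfl | hn
  · exact exists_componentScheme_zero _ _
  set l := Nat.log 2 n + 1 with hl
  have hl1 : 1 ≤ l := by omega
  have hnl : n ≤ 2 ^ l := (Nat.lt_pow_succ_log_self (by norm_num) n).le
  -- Since `t` may far exceed `n`, it is cut down to `min t n`; the number of nodes is then at most
  -- `n ^ 2` and all bit lengths are logarithmic in `n`.
  have hts' : n ≤ min t n * s := by
    rcases min_cases t n with ⟨h, -⟩ | ⟨h, -⟩ <;> rw [h]
    · exact hts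
    · exact Nat.le_mul_of_pos_right n hs
  have hnt : n * min t n ≤ 2 ^ (2 * l) := by
    rw [two_mul, pow_add]
    exact Nat.mul_le_mul hnl ((min_le_right _ _).trans hnl)
  -- The prime must exceed the total violation, which is at most `3 * 2 ^ (4 * l)`, and leave room
  -- for the nodes and the random points.
  obtain ⟨p, hp, hlow, hup⟩ := Nat.exists_prime_lt_and_le_two_mul (2 ^ (4 * l + 4)) (by positivity)
  have hup' : p ≤ 2 ^ (4 * l + 5) := hup.trans_eq (by ring)
  have : Fact p.Prime := ⟨hp⟩
  have hmono {a c : ℕ} (h : a ≤ c) : 2 ^ a ≤ 2 ^ c := Nat.pow_le_pow_right (by norm_num) h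
  -- Soundness needs `9 * (n * min t n) ≤ 2 ^ k`, whence `k = 2 * l + 4`. A token is three vertices
  -- of `l` bits and a field element of `4 * l + 5` bits. The summands of `m` pay for the token
  -- counter, the sketch and the bit buffer.
  obtain ⟨S, hS1, hS2, hS3⟩ := exists_componentScheme (n := n) (t := min t n) (s := s) (p := p)
    (k := 2 * l + 4) (b := 7 * l + 5)
    (m := (2 * l + 2) + (4 * l + 5) * (4 * s + 3) + 2 * (7 * l + 5)) hn (lt_min ht hn) hts'
    (by
      refine lt_of_le_of_lt ?_ hlow
      have h2 : n ^ 2 ≤ 2 ^ (2 * l) := by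
        rw [mul_comm, pow_mul]; exact Nat.pow_le_pow_left hnl 2
      calc n ^ 2 * (2 * n ^ 2 + 1)
          ≤ 2 ^ (2 * l) * (2 * 2 ^ (2 * l) + 2 ^ (2 * l)) :=
            Nat.mul_le_mul h2 (by have := Nat.one_le_two_pow (n := 2 * l); omega)
        _ = 3 * 2 ^ (4 * l) := by ring
        _ ≤ 2 ^ (4 * l + 4) := by rw [pow_add]; omega)
    (hnt.trans ((hmono (by omega)).trans hlow.le))
    ((hmono (by omega)).trans hlow.le)
    (by rw [pow_add]; omega) (by omega)
    (by
      calc n * (n * (n * p)) ≤ 2 ^ l * (2 ^ l * (2 ^ l * 2 ^ (4 * l + 5))) := by gcongr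
        _ = 2 ^ (7 * l + 5) := by ring)
    (by
      have h1 : 3 * (n * min t n) + 1 ≤ 2 ^ (2 * l + 2) := by
        have := Nat.one_le_two_pow (n := 2 * l)
        rw [pow_add]
        omega
      calc (3 * (n * min t n) + 1) * p ^ (4 * s + 3) * 2 ^ (2 * (7 * l + 5))
          ≤ 2 ^ (2 * l + 2) * (2 ^ (4 * l + 5)) ^ (4 * s + 3) * 2 ^ (2 * (7 * l + 5)) := by
            gcongr
        _ = _ := by rw [← pow_mul, ← pow_add, ← pow_add])
  have hls : l ≤ s * l := Nat.le_mul_of_pos_left l hs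
  refine ⟨S, hS1.trans ?_, fun σ hσ => ?_, hS3⟩
  · rw [pow_one]
    nlinarith
  · obtain ⟨H, hH, hpr⟩ := hS2 σ hσ
    refine ⟨H, hH.trans ?_, hpr⟩
    rw [pow_one]
    calc (7 * l + 5) * (3 * (n * min t n)) ≤ (12 * l) * (3 * (n * t)) := by
          gcongr
          · omega
          · exact min_le_left _ _
      _ ≤ 200 * (n * t) * l := by nlinarith [Nat.zero_le (n * t * l)]
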